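/- Let $n\ge 1$ and $1\le p<\infty$. For $u:\mathbb R^n\to\mathbb R\cup\{+\infty\}$ let $u^*(y)=\sup_x(\langle x,y\rangle-u(x))$. Let $\mathcal A_0$ be the set of functions $f=e^{-u}$ (with $e^{-\infty}=0$), where $u:\mathbb R^n\to[0,+\infty]$ is convex, $u(0)=0$, $u^{**}=u$ and $u(x)\to+\infty$ as $\|x\|\to\infty$. For $f=e^{-u}\in\mathcal A_0$ put $h_f=u^*$, $J(f)=\int_{\mathbb R^n}f\,dx$ and $J(f^\diamond)=nJ(f)+\int_{\mathbb R^n} f\log f\,dx$ (with $0\log 0=0$). For $f,g\in\mathcal A_0$ and $t>0$ put $f\oplus_p t\cdot_p g=e^{-w}$ with $w=\big[(h_f^p+t\,h_g^p)^{1/p}\big]^*$, and $$\delta J_p(f,g)=\lim_{t\to0^+}\frac{J(f\oplus_p t\cdot_p g)-J(f)}{t},\qquad \overline\delta J_p(f,g)=\Big(\frac{p\,\delta J_p(f,g)}{J(f^\diamond)}\Big)^{1/p},$$ the first being defined when the limit exists and is finite, the second when moreover $J(f^\diamond)>0$. For $\phi\in GL(n)$ let $\gamma_\phi(x)=e^{-\|\phi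 x\|^2/2}$, and for $T\in GL(n)$ and a function $f$ on $\mathbb R^n$ let $(Tf)(x)=f(Tx)$. For $f\in\mathcal A_0$ consider the problem $S_p$ of maximizing $J(\gamma_\phi)$ over those Gaussians $\gamma_\phi$, $\phi\in GL(n)$, for which $\overline\delta J_p(f,\gamma_\phi)$ is defined and at most $1$. If $S_p$ has exactly one solution $\gamma_\phi$ (as a function), it is called the $L_p$ John ellipsoid of $f$ and denoted by $E_pf$; otherwise $E_pf$ is undefined. Then: 1. For all $f\in\mathcal A_0$ and $T\in GL(n)$, $E_p(Tf)$ is defined if and only if $E_pf$ is defined, and in that case $E_p(Tf)=T(E_pf)$. 2. For every $\phi\in GL(n)$, $E_p(\gamma_\phi)$ is defined and $E_p(\gamma_\phi)=\gamma_\phi$. -/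

import Mathlib

open MeasureTheory Filter Topology
open scoped ENNReal

namespace LpJohn

/-- Euclidean space `ℝⁿ`. -/
abbrev E (n : ℕ) := EuclideanSpace ℝ (Fin n)

/-- The Fenchel conjugate `u*(y) = sup_x (⟨x, y⟩ - u x)`. -/
noncomputable def conj {n : ℕ} (u : E n → EReal) : E n → EReal :=
  fun y => ⨆ x : E n, ((inner ℝ x y : ℝ) : EReal) - u x

/-- Convexity of a function with values in `ℝ ∪ {+∞}`. -/
def IsConvex {n : ℕ} (u : E n → EReal) : Prop :=
  ∀ x y : E n, ∀ t : ℝ, 0 < t → t < 1 →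
    u ((1 - t) • x + t • y) ≤ ((1 - t : ℝ) : EReal) * u x + (t : EReal) * u y

/-- The class `𝓛`: proper convex functions `u : ℝⁿ → ℝ ∪ {+∞}` with
`u x → +∞` as `‖x‖ → ∞`. -/
structure MemL {n : ℕ} (u : E n → EReal) : Prop where
  ne_bot : ∀ x, u x ≠ ⊥
  proper : ∃ x, u x ≠ ⊤
  convex : IsConvex u
  coercive : Tendsto u (cocompact (E n)) (𝓝 ⊤)

/-- The class `𝓛₀`: those `u` in `𝓛` with `u ≥ 0`, `u** = u` and `u(0) = 0`. -/
structure MemL0 {n : ℕ} (u : E n → EReal) : Prop extends MemL u where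
  nonneg : ∀ x, 0 ≤ u x
  biconj : conj (conj u) = u
  zero : u 0 = 0

/-- The function `e^{-u}`, with `e^{-∞} = 0`. -/
noncomputable def expNeg {n : ℕ} (u : E n → EReal) : E n → ℝ :=
  fun x => (EReal.exp (-(u x))).toReal

/-- The class `𝓐₀ = {e^{-u} : u ∈ 𝓛₀}`. -/
def MemA0 {n : ℕ} (f : E n → ℝ) : Prop :=
  ∃ u : E n → EReal, MemL0 u ∧ f = expNeg u

/-- The support function `h_f = (-log f)*`, with `-log 0 = +∞`. -/
noncomputable def supp {n : ℕ} (f : E n → ℝ) : E n → EReal :=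
  conj (fun x => -ENNReal.log (ENNReal.ofReal (f x)))

/-- The `L_p` Asplund combination `α ·_p f ⊕_p β ·_p g = e^{-w}` with
`w = [(α h_f^p + β h_g^p)^{1/p}]*`. For `f`, `g` in `𝓐₀` the support functions take values
in `[0, ∞]`, where the powers are taken. -/
noncomputable def lpAsplund {n : ℕ} (p : ℝ) (α : ℝ≥0∞) (f : E n → ℝ) (β : ℝ≥0∞)
    (g : E n → ℝ) : E n → ℝ :=
  expNeg (conj (fun y =>
    (((α * (supp f y).toENNReal ^ p + β * (supp g y).toENNReal ^ p) ^ (1 / p) : ℝ≥0∞) : EReal)))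

/-- The total mass `J(f) = ∫ f`. -/
noncomputable def J {n : ℕ} (f : E n → ℝ) : ℝ := ∫ x, f x

/-- `J(f^⋄) = n J(f) + ∫ f log f`, with `0 log 0 = 0`. -/
noncomputable def Jdiamond {n : ℕ} (f : E n → ℝ) : ℝ :=
  n * J f + ∫ x, f x * Real.log (f x)

/-- `d` is the first variation `δJ_p(f, g) = lim_{t → 0⁺} (J(f ⊕_p t ·_p g) - J(f)) / t`
(in particular the limit exists and is finite). -/
def HasFirstVariation {n : ℕ} (p : ℝ) (f g : E n → ℝ) (d : ℝ) : Prop :=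
  Tendsto (fun t : ℝ => (J (lpAsplund p 1 f (ENNReal.ofReal t) g) - J f) / t) (𝓝[>] 0) (𝓝 d)

/-- `D` is the normalized first variation `(p δJ_p(f, g) / J(f^⋄))^{1/p}`; it is defined when
`δJ_p(f, g)` is and the normalizing denominator is positive. -/
def HasNormalizedFirstVariation {n : ℕ} (p : ℝ) (f g : E n → ℝ) (D : ℝ) : Prop :=
  0 < Jdiamond f ∧
    ∃ d : ℝ, HasFirstVariation p f g d ∧ D = (p * d / Jdiamond f) ^ (1 / p)

/-- The Gaussian `γ_φ(x) = exp(-‖φ x‖² / 2)`, for `φ ∈ GL(n)`. -/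
noncomputable def gaussian {n : ℕ} (φ : E n ≃L[ℝ] E n) : E n → ℝ :=
  fun x => Real.exp (-‖φ x‖ ^ 2 / 2)

/-- The constraint of problem `S_p`: the normalized first variation of `f` along `g` is
defined and at most one. -/
def Feasible {n : ℕ} (p : ℝ) (f g : E n → ℝ) : Prop :=
  ∃ D : ℝ, HasNormalizedFirstVariation p f g D ∧ D ≤ 1

/-- `g` is a Gaussian solving problem `S_p` for `f`: it maximizes `J(γ_φ)`, `φ ∈ GL(n)`,
subject to the constraint. -/
def Solves {n : ℕ} (p : ℝ) (f g : E n → ℝ) : Prop :=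
  (∃ φ : E n ≃L[ℝ] E n, g = gaussian φ) ∧ Feasible p f g ∧
    ∀ ψ : E n ≃L[ℝ] E n, Feasible p f (gaussian ψ) → J (gaussian ψ) ≤ J g

/-- The `L_p` John ellipsoid `E_p f` of `f ∈ 𝓐₀`: the unique Gaussian that solves problem
`S_p`. It is a partial operation, defined exactly when `f ∈ 𝓐₀` and there is exactly one
solution. -/
noncomputable def lpJohn {n : ℕ} (p : ℝ) (f : E n → ℝ) : Part (E n → ℝ) where
  Dom := MemA0 f ∧ ∃! g : E n → ℝ, Solves p f g
  get h := h.2.exists.choose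

/-- The action of `T ∈ GL(n)` on functions, `(T f)(x) = f(T x)`. -/
def act {n : ℕ} (T : E n ≃L[ℝ] E n) (f : E n → ℝ) : E n → ℝ := fun x => f (T x)

end LpJohn

namespace LpJohn

/-! ### Equivariance under linear changes of variable -/

variable {n : ℕ}

/-! Equivariance: composing `u` with `T` composes its conjugate with the inverse adjoint of `T`, so
the `L_p` combination commutes with `act T`. All integrals scale by the same factor `|det T|⁻¹`,
which cancels in the normalized first variation and does not affect which Gaussian is maximal. Hence
`act T` carries solutions for `f` to solutions for `act T f`, with inverse `act T.symm`.

Since `act φ` sends the standard Gaussian to `gaussian φ`, the second claim reduces to the standard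
Gaussian. Diagonalize a competitor in an orthonormal basis, with weights `μ i`; the standard
Gaussian has weights 1 in any such basis. The power mean inequality (`le_lpMean`) bounds the `L_p`
combination of the two support functions below by a quadratic form. Conjugation reverses order, so
the mass of the combination is at least an explicit product (`prod_le_J_lpAsplund`), with equality
at `t = 0`. Differentiating there bounds the first variation below, and the constraint becomes `∑ (μ
i)⁻¹ ≤ n` (`sum_inv_le_of_feasible`). By AM-GM, in the form `log x ≤ x - 1`, the competitor has no
more mass than the standard Gaussian, with equality only if every `μ i` is 1. The first variation of
a general competitor is never computed; only this one-sided bound is needed. -/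

theorem conj_comp (u : E n → EReal) (T S : E n ≃L[ℝ] E n)
    (h : ∀ x y, inner ℝ (T x) (S y) = inner ℝ x y) :
    conj (u ∘ T) = conj u ∘ S := by
  funext y
  refine Equiv.iSup_congr T.toEquiv fun x => ?_
  simp [← h x y]

theorem exists_inverse_adjoint (T : E n ≃L[ℝ] E n) :
    ∃ S : E n ≃L[ℝ] E n, ∀ x y, inner ℝ (T x) (S y) = inner ℝ x y := by
  refine ⟨ContinuousLinearEquiv.equivOfInverse
    (ContinuousLinearMap.adjoint (T.symm : E n →L[ℝ] E n))
    (ContinuousLinearMap.adjoint (T : E n →L[ℝ] E n)) ?_ ?_, fun x y => ?_⟩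
  · intro x
    refine ext_inner_left ℝ fun v => ?_
    simp [ContinuousLinearMap.adjoint_inner_right]
  · intro x
    refine ext_inner_left ℝ fun v => ?_
    simp [ContinuousLinearMap.adjoint_inner_right]
  · simp [ContinuousLinearMap.adjoint_inner_right]

theorem MemL0.comp {u : E n → EReal} (hu : MemL0 u) (T : E n ≃L[ℝ] E n) :
    MemL0 (u ∘ T) := by
  obtain ⟨S, hS⟩ := exists_inverse_adjoint T
  refine { ne_bot := fun x => hu.ne_bot _, proper := ?_, convex := ?_, coercive := ?_,
           nonneg := fun x => hu.nonneg _, biconj := ?_, zero := ?_ }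
  · obtain ⟨x, hx⟩ := hu.proper
    exact ⟨T.symm x, by simpa using hx⟩
  · intro x y t h0 h1
    simpa using hu.convex (T x) (T y) t h0 h1
  · exact hu.coercive.comp T.toHomeomorph.isClosedEmbedding.tendsto_cocompact
  · rw [conj_comp u T S hS, conj_comp _ S T, hu.biconj]
    intro x y
    rw [real_inner_comm, hS, real_inner_comm]
  · simpa using hu.zero

theorem MemA0.act {f : E n → ℝ} (hf : MemA0 f) (T : E n ≃L[ℝ] E n) : MemA0 (act T f) := by
  obtain ⟨u, hu, rfl⟩ := hf
  exact ⟨u ∘ T, hu.comp T, rfl⟩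

theorem supp_act (f : E n → ℝ) {T S : E n ≃L[ℝ] E n}
    (h : ∀ x y, inner ℝ (T x) (S y) = inner ℝ x y) : supp (act T f) = supp f ∘ S :=
  conj_comp (fun x => -ENNReal.log (ENNReal.ofReal (f x))) T S h

theorem lpAsplund_act (p : ℝ) (α : ℝ≥0∞) (f : E n → ℝ) (β : ℝ≥0∞) (g : E n → ℝ)
    (T : E n ≃L[ℝ] E n) :
    lpAsplund p α (act T f) β (act T g) = act T (lpAsplund p α f β g) := by
  obtain ⟨S, hS⟩ := exists_inverse_adjoint T
  have key := conj_comp (fun y =>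
    (((α * (supp f y).toENNReal ^ p + β * (supp g y).toENNReal ^ p) ^ (1 / p) : ℝ≥0∞) : EReal))
    S T (fun x y => by rw [real_inner_comm, hS, real_inner_comm])
  funext x
  have := congrFun key x
  simp only [lpAsplund, act, expNeg, supp_act _ hS] at this ⊢
  simp only [Function.comp_def] at this ⊢
  rw [this]

/-- No integrability is required: if `f` is not integrable, both integrals are 0. One `c` therefore
serves every mass and entropy integral. -/
theorem exists_integral_comp_eq (T : E n ≃L[ℝ] E n) :
    ∃ c : ℝ, 0 < c ∧ ∀ f : E n → ℝ, ∫ x, f (T x) = c * ∫ x, f x := by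
  have hdet : LinearMap.det ((T : E n →L[ℝ] E n) : E n →ₗ[ℝ] E n) ≠ 0 :=
    T.toLinearEquiv.isUnit_det'.ne_zero
  refine ⟨|(LinearMap.det ((T : E n →L[ℝ] E n) : E n →ₗ[ℝ] E n))⁻¹|,
    abs_pos.2 (inv_ne_zero hdet), fun f => ?_⟩
  have h := T.toHomeomorph.toMeasurableEquiv.measurableEmbedding.integral_map (μ := volume) f
  have h2 := Measure.map_linearMap_addHaar_eq_smul_addHaar (volume : Measure (E n)) hdet
  change Measure.map (T.toHomeomorph.toMeasurableEquiv) volume = _ at h2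
  rw [h2, integral_smul_measure, ENNReal.toReal_ofReal (abs_nonneg _)] at h
  exact h.symm

theorem hasNormalizedFirstVariation_act {p D : ℝ} {f g : E n → ℝ} (T : E n ≃L[ℝ] E n)
    (h : HasNormalizedFirstVariation p f g D) :
    HasNormalizedFirstVariation p (act T f) (act T g) D := by
  obtain ⟨c, hc, hint⟩ := exists_integral_comp_eq T
  have hJ : ∀ f : E n → ℝ, J (act T f) = c * J f := hint
  have hd : ∀ f : E n → ℝ, Jdiamond (act T f) = c * Jdiamond f := fun f => by
    have := hint (fun x => f x * Real.log (f x))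
    simp only [Jdiamond, hJ]
    simp only [act]
    rw [this]
    ring
  obtain ⟨hpos, d, hd1, hd2⟩ := h
  refine ⟨by rw [hd]; positivity, c * d, ?_, ?_⟩
  · refine (hd1.const_mul c).congr fun t => ?_
    rw [lpAsplund_act, hJ, hJ]
    ring
  · rw [hd2, hd, mul_left_comm, mul_div_mul_left _ _ hc.ne']

theorem Feasible.act {p : ℝ} {f g : E n → ℝ} (h : Feasible p f g) (T : E n ≃L[ℝ] E n) :
    Feasible p (act T f) (act T g) := by
  obtain ⟨D, hD, h1⟩ := h
  exact ⟨D, hasNormalizedFirstVariation_act T hD, h1⟩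

theorem act_gaussian (T φ : E n ≃L[ℝ] E n) : act T (gaussian φ) = gaussian (T.trans φ) := rfl

@[simp] theorem act_symm_act (T : E n ≃L[ℝ] E n) (f : E n → ℝ) : act T.symm (act T f) = f := by
  funext x
  simp [act]

@[simp] theorem act_act_symm (T : E n ≃L[ℝ] E n) (f : E n → ℝ) : act T (act T.symm f) = f := by
  funext x
  simp [act]

theorem Solves.act {p : ℝ} {f g : E n → ℝ} (h : Solves p f g) (T : E n ≃L[ℝ] E n) :
    Solves p (act T f) (act T g) := by
  obtain ⟨⟨φ, rfl⟩, hf, hmax⟩ := h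
  refine ⟨⟨T.trans φ, rfl⟩, hf.act T, fun ψ hψ => ?_⟩
  obtain ⟨c, hc, hint⟩ := exists_integral_comp_eq T
  have h1 := hψ.act T.symm
  rw [act_symm_act, act_gaussian] at h1
  have h2 := hmax _ h1
  have h3 : J (gaussian ψ) = c * J (gaussian (T.symm.trans ψ)) := by
    rw [← act_gaussian, J, J, ← hint]
    simp [LpJohn.act]
  rw [h3, show J (LpJohn.act T (gaussian φ)) = c * J (gaussian φ) from hint _]
  exact mul_le_mul_of_nonneg_left h2 hc.le

theorem solves_act_iff {p : ℝ} {f g : E n → ℝ} (T : E n ≃L[ℝ] E n) :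
    Solves p (act T f) g ↔ Solves p f (act T.symm g) := by
  constructor
  · intro h
    simpa using h.act T.symm
  · intro h
    simpa using h.act T

/-- This removes the choice in `lpJohn`. Equality of partial values, covering both definedness and
value, can then be checked through membership. -/
theorem mem_lpJohn_iff {p : ℝ} {f g : E n → ℝ} :
    g ∈ lpJohn p f ↔ MemA0 f ∧ Solves p f g ∧ ∀ g', Solves p f g' → g' = g := by
  constructor
  · rintro ⟨⟨h0, h⟩, rfl⟩
    exact ⟨h0, h.exists.choose_spec, fun g' hg' => h.unique hg' h.exists.choose_spec⟩
  · rintro ⟨h0, h, huniq⟩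
    have hex : ∃! g, Solves p f g := ⟨g, h, huniq⟩
    exact ⟨⟨h0, hex⟩, hex.unique hex.exists.choose_spec h⟩

theorem lpJohn_act (p : ℝ) {f : E n → ℝ} (hf : MemA0 f) (T : E n ≃L[ℝ] E n) :
    lpJohn p (act T f) = (lpJohn p f).map (act T) := by
  ext g
  simp only [Part.mem_map_iff, mem_lpJohn_iff]
  constructor
  · rintro ⟨-, h, huniq⟩
    refine ⟨act T.symm g, ⟨hf, (solves_act_iff T).1 h, fun g' hg' => ?_⟩, by simp⟩
    rw [← huniq _ (hg'.act T), act_symm_act]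
  · rintro ⟨g, ⟨-, h, huniq⟩, rfl⟩
    refine ⟨hf.act T, h.act T, fun g' hg' => ?_⟩
    rw [← huniq _ ((solves_act_iff T).1 hg'), act_act_symm]

/-! ### Quadratic forms and their conjugates -/

/-- The quadratic form `½ ∑ μᵢ xᵢ²` in the coordinates of an orthonormal basis. -/
noncomputable def diagForm (b : OrthonormalBasis (Fin n) ℝ (E n)) (μ : Fin n → ℝ) (x : E n) : ℝ :=
  (∑ i, μ i * b.repr x i ^ 2) / 2

theorem diagForm_nonneg (b : OrthonormalBasis (Fin n) ℝ (E n)) {μ : Fin n → ℝ}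
    (hμ : ∀ i, 0 ≤ μ i) (x : E n) : 0 ≤ diagForm b μ x :=
  div_nonneg (Finset.sum_nonneg fun i _ => mul_nonneg (hμ i) (sq_nonneg _)) (by norm_num)

theorem diagForm_const (b : OrthonormalBasis (Fin n) ℝ (E n)) (c : ℝ) (x : E n) :
    diagForm b (fun _ => c) x = c * ‖x‖ ^ 2 / 2 := by
  rw [diagForm, ← Finset.mul_sum, ← b.repr.norm_map, EuclideanSpace.real_norm_sq_eq]

theorem inner_eq_sum_repr (b : OrthonormalBasis (Fin n) ℝ (E n)) (x y : E n) :
    inner ℝ x y = ∑ i, b.repr x i * b.repr y i := by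
  rw [← b.repr.inner_map_map, PiLp.inner_apply]
  simp [mul_comm]

/-- Young's inequality in each coordinate: the gap is `(μᵢ xᵢ - yᵢ)² / (2 μᵢ)`, so equality holds at
`xᵢ = yᵢ / μᵢ`. -/
theorem inner_le_diagForm_add (b : OrthonormalBasis (Fin n) ℝ (E n)) {μ : Fin n → ℝ}
    (hμ : ∀ i, 0 < μ i) (x y : E n) :
    inner ℝ x y ≤ diagForm b μ x + diagForm b μ⁻¹ y := by
  rw [inner_eq_sum_repr b, diagForm, diagForm, ← add_div, ← Finset.sum_add_distrib,
    Finset.sum_div]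
  refine Finset.sum_le_sum fun i _ => ?_
  have h := hμ i
  have h2 : (μ i * b.repr x i ^ 2 + μ⁻¹ i * b.repr y i ^ 2) / 2 - b.repr x i * b.repr y i
      = (μ i * b.repr x i - b.repr y i) ^ 2 / (2 * μ i) := by
    simp only [Pi.inv_apply]
    field_simp
    ring
  have h3 : 0 ≤ (μ i * b.repr x i - b.repr y i) ^ 2 / (2 * μ i) := by positivity
  linarith

theorem exists_inner_eq_diagForm_add (b : OrthonormalBasis (Fin n) ℝ (E n)) {μ : Fin n → ℝ}
    (hμ : ∀ i, 0 < μ i) (y : E n) :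
    ∃ x, inner ℝ x y = diagForm b μ x + diagForm b μ⁻¹ y := by
  refine ⟨b.repr.symm (WithLp.toLp 2 fun i => b.repr y i / μ i), ?_⟩
  rw [inner_eq_sum_repr b, diagForm, diagForm, ← add_div, ← Finset.sum_add_distrib,
    Finset.sum_div]
  refine Finset.sum_congr rfl fun i _ => ?_
  have h := (hμ i).ne'
  simp only [LinearIsometryEquiv.apply_symm_apply, Pi.inv_apply]
  field_simp
  ring

theorem conj_anti {u v : E n → EReal} (h : ∀ x, u x ≤ v x) (y : E n) : conj v y ≤ conj u y :=
  iSup_mono fun x => EReal.sub_le_sub le_rfl (h x)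

theorem conj_diagForm (b : OrthonormalBasis (Fin n) ℝ (E n)) {μ : Fin n → ℝ}
    (hμ : ∀ i, 0 < μ i) :
    conj (fun x => (diagForm b μ x : EReal)) = fun y => (diagForm b μ⁻¹ y : EReal) := by
  funext y
  refine le_antisymm (iSup_le fun x => ?_) ?_
  · rw [← EReal.coe_sub, EReal.coe_le_coe_iff]
    linarith [inner_le_diagForm_add b hμ x y]
  · obtain ⟨x, hx⟩ := exists_inner_eq_diagForm_add b hμ y
    refine le_iSup_of_le x ?_
    rw [← EReal.coe_sub, EReal.coe_le_coe_iff]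
    linarith

theorem expNeg_coe (q : E n → ℝ) :
    expNeg (fun x => (q x : EReal)) = fun x => Real.exp (-q x) := by
  funext x
  rw [expNeg, ← EReal.coe_neg, EReal.exp_coe, ENNReal.toReal_ofReal (Real.exp_pos _).le]

theorem supp_exp_neg (q : E n → ℝ) :
    supp (fun x => Real.exp (-q x)) = conj (fun x => (q x : EReal)) := by
  unfold supp
  congr 1
  funext x
  rw [ENNReal.log_ofReal_of_pos (Real.exp_pos _), Real.log_exp, EReal.coe_neg, neg_neg]

/-! ### Bounds for the `L_p` mean -/

/-- The real-valued `L_p` combination `(a^p + t b^p)^{1/p}`. -/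
noncomputable def lpMean (p t a b : ℝ) : ℝ := (a ^ p + t * b ^ p) ^ (1 / p)

theorem lpAsplund_exp_neg_diagForm {p t : ℝ} (hp : 1 ≤ p) (ht : 0 ≤ t)
    (b b' : OrthonormalBasis (Fin n) ℝ (E n)) {μ ν : Fin n → ℝ}
    (hμ : ∀ i, 0 < μ i) (hν : ∀ i, 0 < ν i) :
    lpAsplund p 1 (fun x => Real.exp (-diagForm b μ x)) (ENNReal.ofReal t)
      (fun x => Real.exp (-diagForm b' ν x)) =
    expNeg (conj fun y => (lpMean p t (diagForm b μ⁻¹ y) (diagForm b' ν⁻¹ y) : EReal)) := by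
  have hp0 : 0 < p := by linarith
  unfold lpAsplund
  congr 2
  funext y
  have h1 : 0 ≤ diagForm b μ⁻¹ y := diagForm_nonneg b (fun i => (inv_pos.2 (hμ i)).le) y
  have h2 : 0 ≤ diagForm b' ν⁻¹ y := diagForm_nonneg b' (fun i => (inv_pos.2 (hν i)).le) y
  have h3 := Real.rpow_nonneg h1 p
  have h4 := Real.rpow_nonneg h2 p
  rw [supp_exp_neg, supp_exp_neg, conj_diagForm b hμ, conj_diagForm b' hν]
  simp only [EReal.real_coe_toENNReal, one_mul]
  rw [ENNReal.ofReal_rpow_of_nonneg h1 hp0.le, ENNReal.ofReal_rpow_of_nonneg h2 hp0.le,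
    ← ENNReal.ofReal_mul ht, ← ENNReal.ofReal_add h3 (by positivity),
    ENNReal.ofReal_rpow_of_nonneg (by positivity) (by positivity), EReal.coe_ennreal_ofReal,
    max_eq_left (by positivity), lpMean]

/-- Convexity of `x ^ p` with weights `1 / (1 + t)` and `t / (1 + t)`. The bound is linear in `a`
and `b`, so it keeps quadratic forms quadratic, and it is sharp when `a = b`. -/
theorem le_lpMean {p t a b : ℝ} (hp : 1 ≤ p) (ht : 0 ≤ t) (ha : 0 ≤ a) (hb : 0 ≤ b) :
    (1 + t) ^ (1 / p - 1) * (a + t * b) ≤ lpMean p t a b := by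
  have hp0 : 0 < p := by linarith
  have ht1 : 0 < 1 + t := by linarith
  have hc := (convexOn_rpow hp).2 (Set.mem_Ici.2 ha) (Set.mem_Ici.2 hb)
    (show 0 ≤ 1 / (1 + t) by positivity) (show 0 ≤ t / (1 + t) by positivity) (by field_simp)
  simp only [smul_eq_mul] at hc
  have e1 : 1 / (1 + t) * a + t / (1 + t) * b = (a + t * b) / (1 + t) := by ring
  have e2 : 1 / (1 + t) * a ^ p + t / (1 + t) * b ^ p = (a ^ p + t * b ^ p) / (1 + t) := by ring
  have h3 := Real.rpow_nonneg ha p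
  have h4 := Real.rpow_nonneg hb p
  rw [e1, e2] at hc
  have h5 := Real.rpow_le_rpow (by positivity) hc (z := 1 / p) (by positivity)
  rw [← Real.rpow_mul (by positivity), mul_one_div_cancel hp0.ne', Real.rpow_one,
    Real.div_rpow (by positivity) ht1.le, div_le_div_iff₀ ht1 (by positivity)] at h5
  rw [Real.rpow_sub ht1, Real.rpow_one, lpMean, div_mul_eq_mul_div, div_le_iff₀ ht1]
  linarith

/-- A crude bound, used only to dominate the combination by an integrable Gaussian. -/
theorem lpMean_le {p t a b C : ℝ} (hp : 1 ≤ p) (ht : 0 ≤ t) (ha : 0 ≤ a) (hb : 0 ≤ b)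
    (hC : 0 ≤ C) (hab : b ≤ C * a) :
    lpMean p t a b ≤ (1 + t * C ^ p) ^ (1 / p) * a := by
  have hp0 : 0 < p := by linarith
  have h1 := Real.rpow_le_rpow hb hab hp0.le
  rw [Real.mul_rpow hC ha] at h1
  have h3 := Real.rpow_nonneg ha p
  have h4 := Real.rpow_nonneg hb p
  have h5 := Real.rpow_nonneg hC p
  calc lpMean p t a b ≤ ((1 + t * C ^ p) * a ^ p) ^ (1 / p) :=
        Real.rpow_le_rpow (by positivity) (by nlinarith) (by positivity)
    _ = _ := by
        rw [Real.mul_rpow (by positivity) h3, ← Real.rpow_mul ha, mul_one_div_cancel hp0.ne',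
          Real.rpow_one]

theorem lpMean_self {p t a : ℝ} (hp : 1 ≤ p) (ht : 0 ≤ t) (ha : 0 ≤ a) :
    lpMean p t a a = (1 + t) ^ (1 / p) * a := by
  have hp0 : 0 < p := by linarith
  have h3 := Real.rpow_nonneg ha p
  rw [lpMean, ← one_add_mul, Real.mul_rpow (by positivity) h3, ← Real.rpow_mul ha,
    mul_one_div_cancel hp0.ne', Real.rpow_one]

/-! ### Measurability, Gaussian integrals and diagonalization -/

theorem measurable_conj (u : E n → EReal) : Measurable (conj u) := by
  have : conj u = fun y => ⨆ x, ((inner ℝ x y : ℝ) : EReal) - u x := rfl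
  rw [this]
  refine LowerSemicontinuous.measurable (lowerSemicontinuous_iSup fun x => ?_)
  induction h : u x with
  | bot =>
    simpa using lowerSemicontinuous_const
  | top =>
    simpa using lowerSemicontinuous_const
  | coe r =>
    simp only [← EReal.coe_sub]
    exact (continuous_coe_real_ereal.comp (by fun_prop)).lowerSemicontinuous

theorem measurable_expNeg {u : E n → EReal} (hu : Measurable u) : Measurable (expNeg u) := by
  unfold expNeg
  fun_prop

/-- The value `⊥` must be excluded: there the exponential is `⊤`, which `toReal` sends to 0. -/
theorem expNeg_le_expNeg {u v : E n → EReal} {x : E n} (h : u x ≤ v x) (hu : u x ≠ ⊥) :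
    expNeg v x ≤ expNeg u x := by
  refine ENNReal.toReal_mono ?_ (EReal.exp_le_exp_iff.2 (EReal.neg_le_neg_iff.2 h))
  simpa using hu

theorem expNeg_nonneg (u : E n → EReal) (x : E n) : 0 ≤ expNeg u x := ENNReal.toReal_nonneg

theorem integral_comp_repr (b : OrthonormalBasis (Fin n) ℝ (E n)) (F : (Fin n → ℝ) → ℝ) :
    ∫ x, F (fun i => b.repr x i) = ∫ v, F v := by
  rw [← (EuclideanSpace.volume_preserving_symm_measurableEquiv_toLp (Fin n)).integral_comp'
      (g := F)]
  exact b.measurePreserving_repr.integral_comp b.repr.toHomeomorph.measurableEmbedding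
    (fun x : E n => F (fun i => x i))

theorem integral_exp_neg_diagForm (b : OrthonormalBasis (Fin n) ℝ (E n)) (μ : Fin n → ℝ) :
    ∫ x, Real.exp (-diagForm b μ x) = ∏ i, √(2 * Real.pi / μ i) := by
  have h := integral_comp_repr b (fun v => ∏ i, Real.exp (-(μ i / 2) * v i ^ 2))
  have e : ∀ x, Real.exp (-diagForm b μ x) = ∏ i, Real.exp (-(μ i / 2) * b.repr x i ^ 2) := by
    intro x
    rw [← Real.exp_sum, diagForm, Finset.sum_div, ← Finset.sum_neg_distrib]
    congr 1
    exact Finset.sum_congr rfl fun i _ => by ring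
  simp_rw [e]
  rw [h, integral_fintype_prod_volume_eq_prod (fun i (s : ℝ) => Real.exp (-(μ i / 2) * s ^ 2))]
  refine Finset.prod_congr rfl fun i _ => ?_
  rw [integral_gaussian]
  congr 1
  field_simp

theorem integrable_exp_neg_diagForm (b : OrthonormalBasis (Fin n) ℝ (E n)) {μ : Fin n → ℝ}
    (hμ : ∀ i, 0 < μ i) : Integrable fun x => Real.exp (-diagForm b μ x) := by
  -- A non-integrable function has integral 0 by convention, but the computed value is positive.
  by_contra h
  have h1 := integral_undef h
  rw [integral_exp_neg_diagForm] at h1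
  have : 0 < ∏ i, √(2 * Real.pi / μ i) := Finset.prod_pos fun i _ => by
    have := hμ i
    positivity
  exact this.ne' h1

/-- The spectral theorem for `ψ* ψ`; its eigenvalues are the numbers `‖ψ (b i)‖ ^ 2`, positive
because `ψ` is injective. -/
theorem exists_gaussian_eq_exp_neg_diagForm (ψ : E n ≃L[ℝ] E n) :
    ∃ (b : OrthonormalBasis (Fin n) ℝ (E n)) (μ : Fin n → ℝ), (∀ i, 0 < μ i) ∧
      gaussian ψ = fun x => Real.exp (-diagForm b μ x) := by
  let A : E n →L[ℝ] E n := ContinuousLinearMap.adjoint (ψ : E n →L[ℝ] E n) ∘L ψ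
  have hA : ∀ x y, inner ℝ (A x) y = inner ℝ (ψ x) (ψ y) := fun x y => by
    simp [A, ContinuousLinearMap.adjoint_inner_left]
  have hsym : (A : E n →ₗ[ℝ] E n).IsSymmetric := fun x y => by
    change inner ℝ (A x) y = inner ℝ x (A y)
    rw [hA, real_inner_comm (A y), hA, real_inner_comm]
  have hn : Module.finrank ℝ (E n) = n := by simp
  let b := hsym.eigenvectorBasis hn
  have hb : ∀ x i, b.repr (A x) i = hsym.eigenvalues hn i * b.repr x i :=
    fun x i => hsym.eigenvectorBasis_apply_self_apply hn x i
  have hnorm : ∀ x, ‖ψ x‖ ^ 2 = ∑ i, hsym.eigenvalues hn i * b.repr x i ^ 2 := fun x => by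
    rw [← real_inner_self_eq_norm_sq, ← hA, inner_eq_sum_repr b]
    exact Finset.sum_congr rfl fun i _ => by rw [hb]; ring
  refine ⟨b, hsym.eigenvalues hn, fun i => ?_, ?_⟩
  · have h := hnorm (b i)
    have hne : ψ (b i) ≠ 0 := by
      simpa using b.toBasis.ne_zero i
    have h2 : 0 < ‖ψ (b i)‖ ^ 2 := by positivity
    rw [h] at h2
    simpa [b.repr_self, Pi.single_apply, ite_pow] using h2
  · funext x
    rw [gaussian, hnorm, diagForm, neg_div]

theorem gaussian_refl_eq (b : OrthonormalBasis (Fin n) ℝ (E n)) :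
    gaussian (ContinuousLinearEquiv.refl ℝ (E n)) = fun x => Real.exp (-diagForm b 1 x) := by
  funext x
  have := diagForm_const b 1 x
  rw [show (1 : Fin n → ℝ) = fun _ => 1 from rfl, this]
  simp [gaussian, neg_div]

theorem memA0_gaussian_refl : MemA0 (gaussian (ContinuousLinearEquiv.refl ℝ (E n))) := by
  let b := EuclideanSpace.basisFun (Fin n) ℝ
  have hq : ∀ x, diagForm b 1 x = ‖x‖ ^ 2 / 2 := fun x => by
    have := diagForm_const b 1 x
    rw [one_mul] at this
    exact this
  have hconj := conj_diagForm b (μ := 1) (fun _ => one_pos)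
  rw [inv_one] at hconj
  refine ⟨fun x => (diagForm b 1 x : EReal), ?_, by rw [expNeg_coe, gaussian_refl_eq b]⟩
  refine { ne_bot := fun x => EReal.coe_ne_bot _, proper := ⟨0, EReal.coe_ne_top _⟩,
           convex := ?_, coercive := ?_, nonneg := ?_, biconj := by rw [hconj, hconj],
           zero := by simp [hq] }
  · intro x y t h0 h1
    rw [← EReal.coe_mul, ← EReal.coe_mul, ← EReal.coe_add, EReal.coe_le_coe_iff, hq, hq, hq]
    have h2 : ‖(1 - t) • x + t • y‖ ≤ (1 - t) * ‖x‖ + t * ‖y‖ := by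
      refine (norm_add_le _ _).trans_eq ?_
      rw [norm_smul, norm_smul, Real.norm_of_nonneg h0.le, Real.norm_of_nonneg (by linarith)]
    have h3 := pow_le_pow_left₀ (norm_nonneg _) h2 2
    -- The convexity gap of the square is `t (1 - t) (‖x‖ - ‖y‖)²`.
    nlinarith [mul_nonneg (mul_nonneg h0.le (sub_nonneg.2 h1.le)) (sq_nonneg (‖x‖ - ‖y‖))]
  · rw [EReal.tendsto_coe_nhds_top_iff]
    rw [show diagForm b 1 = fun x => ‖x‖ ^ 2 / 2 from funext hq]
    exact ((tendsto_pow_atTop two_ne_zero).comp 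
      (tendsto_norm_cocompact_atTop (E := E n))).atTop_div_const two_pos
  · intro x
    rw [hq]
    exact_mod_cast (by positivity : (0 : ℝ) ≤ ‖x‖ ^ 2 / 2)

theorem integral_sq_mul_exp_neg_half_sq :
    ∫ x : ℝ, x ^ 2 * Real.exp (-(1 / 2) * x ^ 2) = √(2 * Real.pi) := by
  have h1 := integral_comp_abs (f := fun x : ℝ => x ^ 2 * Real.exp (-(1 / 2) * x ^ 2))
  simp only [sq_abs] at h1
  have h2 := integral_rpow_mul_exp_neg_mul_rpow (p := 2) (q := 2) (b := 1 / 2)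
    (by norm_num) (by norm_num) (by norm_num)
  simp only [Real.rpow_two] at h2
  rw [h1, h2, show ((2 : ℝ) + 1) / 2 = 1 / 2 + 1 by norm_num,
    show -((2 : ℝ) + 1) / 2 = -(1 + 1 / 2) by norm_num, Real.Gamma_add_one (by norm_num),
    Real.Gamma_one_half_eq, Real.sqrt_mul (by norm_num), Real.rpow_neg (by norm_num),
    Real.rpow_add (by norm_num), Real.rpow_one, ← Real.sqrt_eq_rpow, Real.sqrt_div (by norm_num),
    Real.sqrt_one]
  field_simp

theorem integrable_sq_mul_exp_neg_half_sq :
    Integrable fun x : ℝ => x ^ 2 * Real.exp (-(1 / 2) * x ^ 2) := by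
  by_contra h
  have h1 := integral_undef h
  rw [integral_sq_mul_exp_neg_half_sq] at h1
  exact (Real.sqrt_pos.2 (by positivity)).ne' h1

theorem integral_exp_mul_diagForm_one (b : OrthonormalBasis (Fin n) ℝ (E n)) :
    ∫ x, Real.exp (-diagForm b 1 x) * diagForm b 1 x =
      n / 2 * ∏ _i : Fin n, √(2 * Real.pi) := by
  -- The `i`-th term of the quadratic form puts a factor `s ^ 2` on coordinate `i` alone. The second
  -- moment equals the mass `√(2π)`, so all `n` terms have the same integral.
  let F : Fin n → Fin n → ℝ → ℝ := fun i j s =>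
    if j = i then s ^ 2 * Real.exp (-(1 / 2) * s ^ 2) else Real.exp (-(1 / 2) * s ^ 2)
  have hF : ∀ i j, Integrable (F i j) ∧ ∫ s, F i j s = √(2 * Real.pi) := fun i j => by
    by_cases h : j = i
    · simp only [F, h, if_true]
      exact ⟨integrable_sq_mul_exp_neg_half_sq, integral_sq_mul_exp_neg_half_sq⟩
    · simp only [F, h, if_false]
      refine ⟨integrable_exp_neg_mul_sq (by norm_num), ?_⟩
      rw [integral_gaussian]
      congr 1
      field_simp
  have hprod : ∀ i (v : Fin n → ℝ), ∏ j, F i j (v j) =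
      v i ^ 2 * ∏ j, Real.exp (-(1 / 2) * v j ^ 2) := fun i v => by
    rw [← Finset.mul_prod_erase _ _ (Finset.mem_univ i),
      ← Finset.mul_prod_erase _ (fun j => Real.exp (-(1 / 2) * v j ^ 2)) (Finset.mem_univ i),
      ← mul_assoc]
    congr 1
    · simp [F]
    · exact Finset.prod_congr rfl fun j hj => by simp [F, Finset.ne_of_mem_erase hj]
  have e : ∀ x, Real.exp (-diagForm b 1 x) * diagForm b 1 x =
      (fun v : Fin n → ℝ => (∑ i, ∏ j, F i j (v j)) / 2) (fun i => b.repr x i) := by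
    intro x
    simp only [hprod]
    rw [← Finset.sum_mul, ← Real.exp_sum, diagForm]
    simp only [Pi.one_apply, one_mul, ← Finset.mul_sum]
    ring_nf
  rw [integral_congr_ae (ae_of_all _ e),
    integral_comp_repr b (fun v => (∑ i, ∏ j, F i j (v j)) / 2), integral_div, integral_finsetSum]
  · simp_rw [integral_fintype_prod_volume_eq_prod, (hF _ _).2]
    simp
    ring
  · exact fun i _ => Integrable.fintype_prod fun j => (hF i j).1

theorem J_exp_neg_diagForm (b : OrthonormalBasis (Fin n) ℝ (E n)) (μ : Fin n → ℝ) :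
    J (fun x => Real.exp (-diagForm b μ x)) = ∏ i, √(2 * Real.pi / μ i) :=
  integral_exp_neg_diagForm b μ

theorem Jdiamond_exp_neg_diagForm_one (b : OrthonormalBasis (Fin n) ℝ (E n)) :
    Jdiamond (fun x => Real.exp (-diagForm b 1 x)) =
      n / 2 * J (fun x => Real.exp (-diagForm b 1 x)) := by
  have h := integral_exp_mul_diagForm_one b
  simp only [Jdiamond, J_exp_neg_diagForm, Real.log_exp, mul_neg, integral_neg]
  rw [h]
  simp only [Pi.one_apply, div_one]
  ring

/-! ### First variation at the standard Gaussian -/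

/-- The lower bound for the mass of the `L_p` combination of two Gaussians with common axes which
the power mean inequality gives. -/
theorem prod_le_J_lpAsplund {p t : ℝ} (hp : 1 ≤ p) (ht : 0 ≤ t)
    (b : OrthonormalBasis (Fin n) ℝ (E n)) {μ : Fin n → ℝ} (hμ : ∀ i, 0 < μ i) :
    ∏ i, √(2 * Real.pi * ((1 + t) ^ (1 / p - 1) * (1 + t * (μ i)⁻¹))) ≤
      J (lpAsplund p 1 (fun x => Real.exp (-diagForm b 1 x)) (ENNReal.ofReal t)
        (fun x => Real.exp (-diagForm b μ x))) := by
  rw [lpAsplund_exp_neg_diagForm hp ht b b (μ := 1) (fun _ => one_pos) hμ]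
  set H : E n → ℝ := fun y => lpMean p t (diagForm b 1⁻¹ y) (diagForm b μ⁻¹ y) with hH
  set m : Fin n → ℝ := fun i => (1 + t) ^ (1 / p - 1) * (1 + t * (μ i)⁻¹) with hm
  have hm0 : ∀ i, 0 < m i := fun i => by
    have := hμ i
    positivity
  have hμ' : ∀ i, 0 ≤ μ⁻¹ i := fun i => (inv_pos.2 (hμ i)).le
  have hq1 : ∀ y, 0 ≤ diagForm b 1⁻¹ y := diagForm_nonneg b (by simp)
  have hqμ : ∀ y, 0 ≤ diagForm b μ⁻¹ y := diagForm_nonneg b hμ'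
  have hlow : ∀ y, diagForm b m y ≤ H y := fun y => by
    refine le_trans (le_of_eq ?_) (le_lpMean hp ht (hq1 y) (hqμ y))
    simp only [diagForm, hm, Pi.inv_apply, Pi.one_apply, inv_one, one_mul, Finset.sum_div,
      Finset.mul_sum, ← Finset.sum_add_distrib]
    exact Finset.sum_congr rfl fun i _ => by ring
  -- Any common upper bound for the `(μ i)⁻¹` would do; the sum avoids a maximum.
  set C : ℝ := ∑ i, (μ i)⁻¹ with hC
  have hC0 : 0 ≤ C := Finset.sum_nonneg fun i _ => hμ' i
  set K : ℝ := (1 + t * C ^ p) ^ (1 / p) with hK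
  have hK0 : 0 < K := by positivity
  have hup : ∀ y, H y ≤ diagForm b (fun _ => K) y := fun y => by
    refine (lpMean_le hp ht (hq1 y) (hqμ y) hC0 ?_).trans_eq ?_
    · simp only [diagForm, Pi.inv_apply, Pi.one_apply, inv_one, one_mul, ← mul_div_assoc,
        Finset.mul_sum]
      gcongr with i _
      exact Finset.single_le_sum (f := fun i => (μ i)⁻¹) (fun i _ => hμ' i) (Finset.mem_univ i)
    · simp only [diagForm, Pi.inv_apply, Pi.one_apply, inv_one, one_mul, Finset.mul_sum,
        ← mul_div_assoc]
      rfl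
  have hc1 : ∀ x, conj (fun y => (H y : EReal)) x ≤ (diagForm b m⁻¹ x : EReal) := fun x => by
    refine (conj_anti (fun y => EReal.coe_le_coe_iff.2 (hlow y)) x).trans_eq ?_
    rw [conj_diagForm b hm0]
  have hc2 : ∀ x, (diagForm b (fun _ => K)⁻¹ x : EReal) ≤ conj (fun y => (H y : EReal)) x :=
    fun x => by
      refine le_trans (le_of_eq ?_) (conj_anti (fun y => EReal.coe_le_coe_iff.2 (hup y)) x)
      rw [conj_diagForm b fun _ => hK0]
  have hb1 : ∀ x, Real.exp (-diagForm b m⁻¹ x) ≤ expNeg (conj fun y => (H y : EReal)) x :=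
    fun x => by
      rw [← congrFun (expNeg_coe (diagForm b m⁻¹)) x]
      exact expNeg_le_expNeg (hc1 x) (ne_bot_of_le_ne_bot (EReal.coe_ne_bot _) (hc2 x))
  have hb2 : ∀ x, expNeg (conj fun y => (H y : EReal)) x ≤
      Real.exp (-diagForm b (fun _ => K)⁻¹ x) := fun x => by
    rw [← congrFun (expNeg_coe (diagForm b (fun _ => K)⁻¹)) x]
    exact expNeg_le_expNeg (hc2 x) (EReal.coe_ne_bot _)
  have hint : Integrable (expNeg (conj fun y => (H y : EReal))) := by
    refine (integrable_exp_neg_diagForm b (μ := (fun _ => K)⁻¹) fun i => inv_pos.2 hK0).mono'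
      (measurable_expNeg (measurable_conj _)).aestronglyMeasurable (ae_of_all _ fun x => ?_)
    rw [Real.norm_of_nonneg (expNeg_nonneg _ _)]
    exact hb2 x
  have hfin := integral_mono (integrable_exp_neg_diagForm b (μ := m⁻¹) fun i => inv_pos.2 (hm0 i))
    hint hb1
  rw [integral_exp_neg_diagForm] at hfin
  simp only [Pi.inv_apply, div_inv_eq_mul] at hfin
  exact hfin

theorem J_lpAsplund_self {p t : ℝ} (hp : 1 ≤ p) (ht : 0 ≤ t)
    (b : OrthonormalBasis (Fin n) ℝ (E n)) :
    J (lpAsplund p 1 (fun x => Real.exp (-diagForm b 1 x)) (ENNReal.ofReal t)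
        (fun x => Real.exp (-diagForm b 1 x))) = ∏ _i : Fin n, √(2 * Real.pi * (1 + t) ^ (1 / p)) := by
  rw [lpAsplund_exp_neg_diagForm hp ht b b (μ := 1) (ν := 1) (fun _ => one_pos) (fun _ => one_pos)]
  have hq1 : ∀ y, 0 ≤ diagForm b 1⁻¹ y := diagForm_nonneg b (by simp)
  have h1 : ∀ y, lpMean p t (diagForm b 1⁻¹ y) (diagForm b 1⁻¹ y) =
      diagForm b (fun _ => (1 + t) ^ (1 / p)) y := fun y => by
    rw [lpMean_self hp ht (hq1 y)]
    simp only [diagForm, Pi.inv_apply, Pi.one_apply, inv_one, one_mul, Finset.mul_sum,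
      ← mul_div_assoc]
  simp_rw [h1]
  rw [conj_diagForm b fun _ => by positivity, expNeg_coe, J_exp_neg_diagForm]
  simp

/-- Serves twice: `a = 1 / p`, `l = 0` gives the exact variation of the standard Gaussian along
itself, and `a = 1 / p - 1`, `l i = (μ i)⁻¹` gives the lower bound for a competitor. -/
theorem hasDerivAt_prod_sqrt {a : ℝ} {l : Fin n → ℝ} :
    HasDerivAt (fun t : ℝ => ∏ i, √(2 * Real.pi * ((1 + t) ^ a * (1 + t * l i))))
      ((∏ _i : Fin n, √(2 * Real.pi)) * ((∑ i, (a + l i)) / 2)) 0 := by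
  have h1 : ∀ i, HasDerivAt (fun t : ℝ => √(2 * Real.pi * ((1 + t) ^ a * (1 + t * l i))))
      (√(2 * Real.pi) * ((a + l i) / 2)) 0 := fun i => by
    have h2 : HasDerivAt (fun t : ℝ => (1 + t) ^ a * (1 + t * l i)) (a + l i) 0 := by
      have h3 : HasDerivAt (fun t : ℝ => 1 + t) 1 0 := (hasDerivAt_id 0).const_add 1
      have h4 := h3.rpow_const (p := a) (Or.inl (by norm_num))
      have h5 := ((hasDerivAt_id (0 : ℝ)).mul_const (l i)).const_add 1
      exact (h4.fun_mul h5).congr_deriv (by simp)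
    have h6 := (h2.const_mul (2 * Real.pi)).sqrt (by simp [Real.pi_ne_zero])
    refine h6.congr_deriv ?_
    have h7 : 0 < √(2 * Real.pi) := by positivity
    have h8 : √(2 * Real.pi) ^ 2 = 2 * Real.pi := Real.sq_sqrt (by positivity)
    simp only [add_zero, Real.one_rpow, zero_mul, mul_one]
    rw [div_eq_iff (by positivity)]
    linear_combination -(a + l i) * h8
  refine (HasDerivAt.fun_finsetProd (u := Finset.univ) fun i _ => h1 i).congr_deriv ?_
  rw [Finset.sum_div, Finset.mul_sum]
  refine Finset.sum_congr rfl fun i hi => Eq.symm ?_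
  simp only [add_zero, Real.one_rpow, zero_mul, mul_one, smul_eq_mul]
  rw [← mul_assoc, Finset.prod_erase_mul _ _ hi]

theorem feasible_iff {p : ℝ} {f g : E n → ℝ} :
    Feasible p f g ↔
      0 < Jdiamond f ∧ ∃ d, HasFirstVariation p f g d ∧ (p * d / Jdiamond f) ^ (1 / p) ≤ 1 := by
  constructor
  · rintro ⟨_, ⟨h0, d, hd, rfl⟩, h1⟩
    exact ⟨h0, d, hd, h1⟩
  · rintro ⟨h0, d, hd, h1⟩
    exact ⟨_, ⟨h0, d, hd, rfl⟩, h1⟩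

theorem prod_sqrt_two_pi_pos : 0 < ∏ _i : Fin n, √(2 * Real.pi) :=
  Finset.prod_pos fun _ _ => by positivity

theorem J_exp_neg_diagForm_one (b : OrthonormalBasis (Fin n) ℝ (E n)) :
    J (fun x => Real.exp (-diagForm b 1 x)) = ∏ _i : Fin n, √(2 * Real.pi) := by
  simp [J_exp_neg_diagForm]

theorem feasible_exp_neg_diagForm_one (hn : 1 ≤ n) {p : ℝ} (hp : 1 ≤ p)
    (b : OrthonormalBasis (Fin n) ℝ (E n)) :
    Feasible p (fun x => Real.exp (-diagForm b 1 x)) (fun x => Real.exp (-diagForm b 1 x)) := by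
  have hp0 : 0 < p := by linarith
  have hn0 : (0 : ℝ) < n := by exact_mod_cast hn
  have hJ := prod_sqrt_two_pi_pos (n := n)
  rw [feasible_iff, Jdiamond_exp_neg_diagForm_one, J_exp_neg_diagForm_one]
  refine ⟨by positivity, (∏ _i : Fin n, √(2 * Real.pi)) * ((∑ _i : Fin n, (1 / p + 0)) / 2), ?_, ?_⟩
  · have h := (hasDerivAt_prod_sqrt (n := n) (a := 1 / p) (l := fun _ => 0)).tendsto_slope_zero_right
    refine h.congr' ?_
    filter_upwards [self_mem_nhdsWithin] with t ht
    rw [J_lpAsplund_self hp (le_of_lt ht), J_exp_neg_diagForm_one]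
    simp [div_eq_inv_mul]
  -- The constraint is attained with equality.
  · have : p * ((∏ _i : Fin n, √(2 * Real.pi)) * ((∑ _i : Fin n, (1 / p + 0)) / 2)) /
        (n / 2 * ∏ _i : Fin n, √(2 * Real.pi)) = 1 := by
      rw [div_eq_one_iff_eq (by positivity), Finset.sum_const, Finset.card_univ, Fintype.card_fin,
        nsmul_eq_mul]
      field_simp
      ring
    rw [this, Real.one_rpow]

theorem sum_inv_le_of_feasible (hn : 1 ≤ n) {p : ℝ} (hp : 1 ≤ p)
    (b : OrthonormalBasis (Fin n) ℝ (E n)) {μ : Fin n → ℝ} (hμ : ∀ i, 0 < μ i)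
    (h : Feasible p (fun x => Real.exp (-diagForm b 1 x)) (fun x => Real.exp (-diagForm b μ x))) :
    ∑ i, (μ i)⁻¹ ≤ n := by
  have hp0 : 0 < p := by linarith
  have hn0 : (0 : ℝ) < n := by exact_mod_cast hn
  have hJ := prod_sqrt_two_pi_pos (n := n)
  rw [feasible_iff, Jdiamond_exp_neg_diagForm_one,
    J_exp_neg_diagForm_one] at h
  obtain ⟨-, d, hd, h1⟩ := h
  have h2 : p * d / (n / 2 * ∏ _i : Fin n, √(2 * Real.pi)) ≤ 1 := by
    -- Arguing from a base above 1 avoids having to know that the quotient is nonnegative.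
    by_contra! hlt
    exact absurd h1 (not_le.2 (Real.one_lt_rpow hlt (by positivity)))
  have h3 := (hasDerivAt_prod_sqrt (n := n) (a := 1 / p - 1)
    (l := fun i => (μ i)⁻¹)).tendsto_slope_zero_right
  have h4 : (∏ _i : Fin n, √(2 * Real.pi)) * ((∑ i, (1 / p - 1 + (μ i)⁻¹)) / 2) ≤ d := by
    -- The product and the mass agree at `t = 0`, so their inequality for `t > 0` passes to
    -- difference quotients and then to limits.
    refine le_of_tendsto_of_tendsto h3 hd ?_
    filter_upwards [self_mem_nhdsWithin] with t ht
    have ht0 : 0 < t := ht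
    rw [div_eq_inv_mul (_ - _) t, smul_eq_mul, J_exp_neg_diagForm_one]
    refine mul_le_mul_of_nonneg_left ?_ (inv_nonneg.2 ht0.le)
    simpa using prod_le_J_lpAsplund hp ht0.le b hμ
  rw [div_le_one (by positivity)] at h2
  rw [Finset.sum_add_distrib, Finset.sum_const, Finset.card_univ, Fintype.card_fin,
    nsmul_eq_mul] at h4
  have h5 := mul_le_mul_of_nonneg_left h4 hp0.le
  have h6 : (∏ _i : Fin n, √(2 * Real.pi)) *
      (p * ((n * (1 / p - 1) + ∑ i, (μ i)⁻¹) / 2)) ≤ (∏ _i : Fin n, √(2 * Real.pi)) * (n / 2) := by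
    linarith
  have h7 := le_of_mul_le_mul_left h6 hJ
  have h8 : p * ((n * (1 / p - 1) + ∑ i, (μ i)⁻¹) / 2) =
      (n - p * n + p * ∑ i, (μ i)⁻¹) / 2 := by
    field_simp
  rw [h8] at h7
  refine le_of_mul_le_mul_left ?_ hp0
  linarith

/-! ### AM-GM and uniqueness of the maximizer -/

theorem prod_sqrt_div_eq (μ : Fin n → ℝ) (hμ : ∀ i, 0 < μ i) :
    ∏ i, √(2 * Real.pi / μ i) =
      (∏ _i : Fin n, √(2 * Real.pi)) * Real.exp ((∑ i, Real.log (μ i)⁻¹) / 2) := by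
  rw [Finset.sum_div, Real.exp_sum, ← Finset.prod_mul_distrib]
  refine Finset.prod_congr rfl fun i _ => ?_
  rw [div_eq_mul_inv, Real.sqrt_mul (by positivity), Real.exp_half,
    Real.exp_log (inv_pos.2 (hμ i))]

theorem sum_log_nonpos {l : Fin n → ℝ} (hl : ∀ i, 0 < l i) (hs : ∑ i, l i ≤ n) :
    ∑ i, Real.log (l i) ≤ 0 := by
  have h : ∑ i, Real.log (l i) ≤ ∑ i, (l i - 1) :=
    Finset.sum_le_sum fun i _ => Real.log_le_sub_one_of_pos (hl i)
  simp only [Finset.sum_sub_distrib, Finset.sum_const, Finset.card_univ, Fintype.card_fin,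
    nsmul_eq_mul, mul_one] at h
  linarith

theorem eq_one_of_sum_log_nonneg {l : Fin n → ℝ} (hl : ∀ i, 0 < l i) (hs : ∑ i, l i ≤ n)
    (h0 : 0 ≤ ∑ i, Real.log (l i)) (i : Fin n) : l i = 1 := by
  by_contra hne
  have h : ∑ i, Real.log (l i) < ∑ i, (l i - 1) :=
    Finset.sum_lt_sum (fun i _ => Real.log_le_sub_one_of_pos (hl i))
      ⟨i, Finset.mem_univ i, Real.log_lt_sub_one_of_pos (hl i) hne⟩
  simp only [Finset.sum_sub_distrib, Finset.sum_const, Finset.card_univ, Fintype.card_fin,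
    nsmul_eq_mul, mul_one] at h
  linarith

theorem J_le_of_feasible (hn : 1 ≤ n) {p : ℝ} (hp : 1 ≤ p) (ψ : E n ≃L[ℝ] E n)
    (h : Feasible p (gaussian (ContinuousLinearEquiv.refl ℝ (E n))) (gaussian ψ)) :
    J (gaussian ψ) ≤ J (gaussian (ContinuousLinearEquiv.refl ℝ (E n))) ∧
      (J (gaussian (ContinuousLinearEquiv.refl ℝ (E n))) ≤ J (gaussian ψ) →
        gaussian ψ = gaussian (ContinuousLinearEquiv.refl ℝ (E n))) := by
  obtain ⟨b, μ, hμ, hψ⟩ := exists_gaussian_eq_exp_neg_diagForm ψ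
  rw [gaussian_refl_eq b, hψ] at h ⊢
  have hs := sum_inv_le_of_feasible hn hp b hμ h
  have hl : ∀ i, 0 < (μ i)⁻¹ := fun i => inv_pos.2 (hμ i)
  have hJ := prod_sqrt_two_pi_pos (n := n)
  rw [J_exp_neg_diagForm_one, J_exp_neg_diagForm, prod_sqrt_div_eq μ hμ]
  constructor
  · refine mul_le_of_le_one_right hJ.le (Real.exp_le_one_iff.2 ?_)
    linarith [sum_log_nonpos hl hs]
  · intro hle
    have h1 : 1 ≤ Real.exp ((∑ i, Real.log (μ i)⁻¹) / 2) := (le_mul_iff_one_le_right hJ).1 hle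
    rw [Real.one_le_exp_iff] at h1
    have h2 := eq_one_of_sum_log_nonneg hl hs (by linarith)
    have h3 : μ = 1 := funext fun i => inv_eq_one.1 (h2 i)
    rw [h3]

theorem lpJohn_gaussian_refl (hn : 1 ≤ n) {p : ℝ} (hp : 1 ≤ p) :
    lpJohn p (gaussian (ContinuousLinearEquiv.refl ℝ (E n))) =
      Part.some (gaussian (ContinuousLinearEquiv.refl ℝ (E n))) := by
  have hfeas : Feasible p (gaussian (ContinuousLinearEquiv.refl ℝ (E n)))
      (gaussian (ContinuousLinearEquiv.refl ℝ (E n))) := by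
    rw [gaussian_refl_eq (EuclideanSpace.basisFun (Fin n) ℝ)]
    exact feasible_exp_neg_diagForm_one hn hp _
  rw [Part.eq_some_iff, mem_lpJohn_iff]
  refine ⟨memA0_gaussian_refl,
    ⟨⟨_, rfl⟩, hfeas, fun ψ hψ => (J_le_of_feasible hn hp ψ hψ).1⟩, ?_⟩
  rintro _ ⟨⟨ψ, rfl⟩, hψ, hmax⟩
  exact (J_le_of_feasible hn hp ψ hψ).2 (hmax _ hfeas)

end LpJohn

theorem proposition3p11 (n : ℕ) (hn : 1 ≤ n) (p : ℝ) (hp : 1 ≤ p) :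
    (∀ (f : LpJohn.E n → ℝ), LpJohn.MemA0 f → ∀ T : LpJohn.E n ≃L[ℝ] LpJohn.E n,
      LpJohn.lpJohn p (LpJohn.act T f) = (LpJohn.lpJohn p f).map (LpJohn.act T)) ∧
    (∀ φ : LpJohn.E n ≃L[ℝ] LpJohn.E n,
      LpJohn.lpJohn p (LpJohn.gaussian φ) = Part.some (LpJohn.gaussian φ)) := by
  refine ⟨fun f hf T => LpJohn.lpJohn_act p hf T, fun φ => ?_⟩
  have h := LpJohn.lpJohn_act p (LpJohn.memA0_gaussian_refl (n := n)) φ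
  rwa [LpJohn.lpJohn_gaussian_refl hn hp, Part.map_some, LpJohn.act_gaussian] at h
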